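/- In the fully online matching model, the vertices of an unweighted finite graph arrive and depart over time. When a vertex arrives, its edges to previously arrived vertices, all of which are still present, are revealed; deadlines are not known before they occur, and every vertex eventually departs. A (deterministic) fractional online algorithm irrevocably maintains a fractional matching, i.e., nonnegative values on the edges such that the values on the edges at each vertex sum to at most $1$; at any time it may increase, based only on the events so far, the value of an edge whose two endpoints have both arrived and have not departed (at the moment of a vertex's departure its edges may be used for the last time). The algorithm is $\alpha$-competitive on a class of graphs if, on every instance whose graph lies in the class, the total value of its final fractional matching is at least $\alpha$ times the size of a maximum matching of the graph. Theorem. If a fractional online algorithm for fully online matching is $\alpha$-competitive, then $\alpha \le 0.6297$; that is, the competitive ratio of any fractional algorithm is at most $0.6297$. This holds even if $\alpha$-competitiveness is required on bipartite graphs only. -/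

import Mathlib

namespace FullyOnline

/-- An event of a fully online matching instance. Vertices are named by their order of arrival:
the `i`-th vertex to arrive is `i` (counting from `0`), so that names carry no information.
`arrive N` is the arrival of the next vertex, whose edges to the set `N` of previously arrived
vertices are revealed; `depart v` is the departure (deadline) of the vertex `v`. -/
inductive Event : Type
  | arrive (N : Finset ℕ) : Event
  | depart (v : ℕ) : Event

/-- The sets of earlier neighbours of the arriving vertices, in order of arrival. -/
def arrivals : List Event → List (Finset ℕ)
  | [] => []
  | Event.arrive N :: h => N :: arrivals h
  | Event.depart _ :: h => arrivals h

/-- The number of vertices that have arrived in the course of the history `h`. -/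
def numArrived (h : List Event) : ℕ := (arrivals h).length

/-- The vertex `v` has arrived and not departed after the history `h`. -/
def Present (h : List Event) (v : ℕ) : Prop :=
  v < numArrived h ∧ Event.depart v ∉ h

/-- The possible histories (chronological lists of events). An arriving vertex has edges only to
vertices that are present, and only present vertices depart. -/
inductive Valid : List Event → Prop
  | nil : Valid []
  | arrive {h : List Event} {N : Finset ℕ} (hh : Valid h) (hN : ∀ u ∈ N, Present h u) :
      Valid (h ++ [Event.arrive N])
  | depart {h : List Event} {v : ℕ} (hh : Valid h) (hv : Present h v) :
      Valid (h ++ [Event.depart v])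

/-- A complete instance: a possible history at whose end every vertex has departed. -/
def IsInstance (h : List Event) : Prop :=
  Valid h ∧ ∀ v < numArrived h, Event.depart v ∈ h

/-- The graph revealed by the history `h`. Its vertices are those below `numArrived h`; the
other natural numbers are isolated. -/
def graph (h : List Event) : SimpleGraph ℕ :=
  SimpleGraph.fromRel fun u v => ∃ N, (arrivals h)[v]? = some N ∧ u ∈ N

/-- The number of edges of a maximum matching of the graph revealed by `h`. Every edge of
this graph joins two vertices that are present at a common time, so for an instance this is the
number of matches that an omniscient optimum makes. -/
noncomputable def opt (h : List Event) : ℕ :=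
  sSup {k : ℕ | ∃ M : (graph h).Subgraph, M.IsMatching ∧ M.edgeSet.ncard = k}

/-- In response to the event `e` following the history `h`, value may be put on the edge `s` if
both of its endpoints have arrived (up to and including `e`) and none of them departed
before `e`. In particular a departing vertex can be matched at its departure for the last time. -/
def Matchable (h : List Event) (e : Event) (s : Sym2 ℕ) : Prop :=
  s ∈ (graph (h ++ [e])).edgeSet ∧ ∀ v ∈ s, Event.depart v ∉ h

/-- A (deterministic) fractional online algorithm. It maintains a fractional matching `x`,
which is a function of the events so far, hence knows neither future arrivals nor
deadlines that have not been reached. Its decisions are irrevocable. -/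
structure FractionalAlgorithm where
  /-- `x h s` is the total value on the edge `s` after the response to the last event of `h`. -/
  x : List Event → Sym2 ℕ → ℝ
  /-- Initially nothing is matched. -/
  start : ∀ s, x [] s = 0
  /-- Value is never taken back. -/
  mono : ∀ h e, Valid (h ++ [e]) → ∀ s, x h s ≤ x (h ++ [e]) s
  /-- Value is added only on edges between vertices that are available. -/
  frozen : ∀ h e, Valid (h ++ [e]) → ∀ s, ¬ Matchable h e s → x (h ++ [e]) s = x h s
  /-- Every vertex is matched to a total fraction of at most one. -/
  load_le : ∀ h, Valid h → ∀ v, ∑ u ∈ Finset.range (numArrived h), x h s(u, v) ≤ 1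

namespace FractionalAlgorithm

/-- The value of the final fractional matching. The sum ranges over all unordered pairs of
vertices; the value on a pair that is not an edge is zero. -/
noncomputable def value (A : FractionalAlgorithm) (h : List Event) : ℝ :=
  ∑ s ∈ (Finset.range (numArrived h)).sym2, A.x h s

/-- The algorithm is `α`-competitive on the instances whose graph belongs to the class `P`. -/
def IsCompetitiveOn (A : FractionalAlgorithm) (P : SimpleGraph ℕ → Prop) (α : ℝ) : Prop :=
  ∀ h, IsInstance h → P (graph h) → α * (opt h : ℝ) ≤ A.value h

/-- The algorithm is `α`-competitive for fully online matching (on all graphs). -/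
def IsCompetitive (A : FractionalAlgorithm) (α : ℝ) : Prop :=
  A.IsCompetitiveOn (fun _ => True) α

/-- The algorithm is `α`-competitive for fully online matching on bipartite graphs. -/
def IsCompetitiveOnBipartite (A : FractionalAlgorithm) (α : ℝ) : Prop :=
  A.IsCompetitiveOn (fun G => G.IsBipartite) α

end FractionalAlgorithm

end FullyOnline

/-!
The adversary plays against the given algorithm and adapts to its choices. At any time there is a
set `S` of vertices that look alike to the algorithm and whose partners in the optimum are still to
come (`Position`). Two kinds of moves are used, both of which add a complete bipartite block.

* A new vertex arrives, adjacent to all of `S`, and departs (`Position.exists_online_vertex`). The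
  algorithm spreads at most `1` over `S`, and a least loaded `s ∈ S` is declared to be its optimal
  partner. This is the upper triangular instance of classic online bipartite matching; repeated
  for ever, it gives `1 - 1/e ≈ 0.632`.
* Many new vertices arrive, adjacent to all of `S`, and then `S` departs
  (`Position.exists_change_sides`). The vertices of `S` have lost capacity in earlier moves, so they
  contribute less than fresh online vertices would, and what they contribute loads the new vertices,
  which form the next `S`, apart from the optimal partners of the old ones.

The classic moves alone waste the load of the vertices that are discarded. The change of sides
wastes in addition the load which the departing vertices have received: they play the role of
online vertices with reduced capacity. With `30` vertices of which `12` are discarded, a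
change of sides from the other `18` to `90` vertices, and the classic instance on the `72` that
remain of these, the optimum is `12 + 18 + 72 = 102` and the algorithm gains at most `64.04`.

The gain is bounded by linear programming duality: in `Position.exists_triangular` the average load
of the current set has a price `lam`, and each unit of value put on `j` remaining vertices costs
`lam / j`. Choosing the prices to match between the phases makes the algorithm's loads cancel,
and what remains is a numerical sum.
-/

namespace FullyOnline

/-! ### Histories and their graphs -/

lemma arrivals_append (h l : List Event) : arrivals (h ++ l) = arrivals h ++ arrivals l := by
  induction h with
  | nil => rfl
  | cons e h ih => cases e <;> simp [arrivals, ih]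

lemma arrivals_replicate (p : ℕ) (S : Finset ℕ) :
    arrivals (List.replicate p (Event.arrive S)) = List.replicate p S := by
  induction p with
  | zero => rfl
  | succ p ih => simp [List.replicate_succ, arrivals, ih]

lemma arrivals_map_depart (ds : List ℕ) : arrivals (ds.map Event.depart) = [] := by
  induction ds with
  | nil => rfl
  | cons d ds ih => simpa [arrivals] using ih

lemma numArrived_append (h l : List Event) :
    numArrived (h ++ l) = numArrived h + numArrived l := by
  simp [numArrived, arrivals_append]

lemma numArrived_replicate (p : ℕ) (S : Finset ℕ) :
    numArrived (List.replicate p (Event.arrive S)) = p := by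
  simp [numArrived, arrivals_replicate]

lemma numArrived_map_depart (ds : List ℕ) : numArrived (ds.map Event.depart) = 0 := by
  simp [numArrived, arrivals_map_depart]

lemma graph_adj {h : List Event} {u v : ℕ} : (graph h).Adj u v ↔ u ≠ v ∧
    ((∃ N, (arrivals h)[v]? = some N ∧ u ∈ N) ∨ ∃ N, (arrivals h)[u]? = some N ∧ v ∈ N) := by
  simp [graph, SimpleGraph.fromRel_adj]

lemma graph_append_depart (h : List Event) (ds : List ℕ) :
    graph (h ++ ds.map Event.depart) = graph h := by
  simp [graph, arrivals_append, arrivals_map_depart]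

lemma graph_mono (h l : List Event) : graph h ≤ graph (h ++ l) := by
  have key : ∀ (w : ℕ) (N : Finset ℕ), (arrivals h)[w]? = some N →
      (arrivals (h ++ l))[w]? = some N := fun w N hN => by
    rw [arrivals_append, List.getElem?_append_left (List.getElem?_eq_some_iff.1 hN).1, hN]
  intro u v huv
  rw [graph_adj] at huv ⊢
  exact ⟨huv.1, huv.2.imp (fun ⟨N, h1, h2⟩ => ⟨N, key _ _ h1, h2⟩)
    (fun ⟨N, h1, h2⟩ => ⟨N, key _ _ h1, h2⟩)⟩

lemma Valid.of_append {h l : List Event} (hv : Valid (h ++ l)) : Valid h := by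
  induction l using List.reverseRecOn with
  | nil => simpa using hv
  | append_singleton l e ih =>
    apply ih
    generalize hg : h ++ (l ++ [e]) = g at hv
    rw [← List.append_assoc] at hg
    cases hv with
    | nil => simp at hg
    | arrive hh hN => rw [List.append_inj_left' hg rfl]; exact hh
    | depart hh hN => rw [List.append_inj_left' hg rfl]; exact hh

/-- A vertex is adjacent on arrival only to vertices with a smaller name. -/
lemma Valid.lt_of_mem_arrivals {h : List Event} (hv : Valid h) {v u : ℕ} {N : Finset ℕ}
    (hN : (arrivals h)[v]? = some N) (hu : u ∈ N) : u < v := by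
  induction hv with
  | nil => simp [arrivals] at hN
  | @arrive h M hh hM ih =>
    rw [arrivals_append] at hN
    rcases lt_or_ge v (arrivals h).length with hlt | hge
    · rw [List.getElem?_append_left hlt] at hN
      exact ih hN
    · have hMN : M = N := by
        rw [List.getElem?_append_right hge] at hN
        simp only [arrivals] at hN
        rw [List.getElem?_singleton] at hN
        split_ifs at hN
        simpa using hN
      subst hMN
      exact lt_of_lt_of_le (hM u hu).1 hge
  | depart hh _ ih =>
    rw [arrivals_append] at hN
    exact ih (by simpa [arrivals] using hN)

lemma Valid.lt_numArrived {h : List Event} (hv : Valid h) {u v : ℕ} (huv : (graph h).Adj u v) :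
    u < numArrived h ∧ v < numArrived h := by
  rw [graph_adj] at huv
  have key : ∀ a b : ℕ, (∃ N, (arrivals h)[b]? = some N ∧ a ∈ N) →
      a < numArrived h ∧ b < numArrived h := by
    rintro a b ⟨N, hN, ha⟩
    have hb : b < numArrived h := (List.getElem?_eq_some_iff.1 hN).1
    exact ⟨(hv.lt_of_mem_arrivals hN ha).trans hb, hb⟩
  rcases huv.2 with h1 | h1
  · exact key _ _ h1
  · exact (key _ _ h1).symm

lemma Valid.not_depart_mem {h : List Event} (hv : Valid h) {v : ℕ} (hn : numArrived h ≤ v) :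
    Event.depart v ∉ h := by
  induction hv with
  | nil => simp
  | arrive hh hM ih =>
    rw [numArrived_append] at hn
    simpa using ih (by omega)
  | @depart h w hh hw ih =>
    have h0 : numArrived [Event.depart w] = 0 := rfl
    rw [numArrived_append, h0] at hn
    simp only [List.mem_append, List.mem_singleton, not_or]
    refine ⟨ih (by omega), fun he => ?_⟩
    have := hw.1
    cases he
    omega

lemma Valid.replicate_arrive {h : List Event} (hv : Valid h) {S : Finset ℕ}
    (hS : ∀ u ∈ S, Present h u) (p : ℕ) :
    Valid (h ++ List.replicate p (Event.arrive S)) := by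
  induction p with
  | zero => simpa using hv
  | succ p ih =>
    rw [List.replicate_succ', ← List.append_assoc]
    refine .arrive ih fun u hu => ⟨?_, ?_⟩
    · rw [numArrived_append]
      exact (hS u hu).1.trans_le (Nat.le_add_right _ _)
    · have := (hS u hu).2
      simp [this]

lemma Valid.map_depart {h : List Event} (hv : Valid h) {ds : List ℕ} (hnd : ds.Nodup)
    (hds : ∀ u ∈ ds, Present h u) : Valid (h ++ ds.map Event.depart) := by
  induction ds using List.reverseRecOn with
  | nil => simpa using hv
  | append_singleton ds d ih =>
    rw [List.map_append, ← List.append_assoc]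
    have hnd' := List.nodup_append.1 hnd
    refine .depart (ih hnd'.1 fun u hu => hds u (by simp [hu])) ⟨?_, ?_⟩
    · rw [numArrived_append]
      exact (hds d (by simp)).1.trans_le (Nat.le_add_right _ _)
    · have h1 := (hds d (by simp)).2
      have h2 : d ∉ ds := fun hd => hnd'.2.2 d hd d (by simp) rfl
      simp [h1, h2]

/-- Every edge has an endpoint that has departed, so that no edge can still gain value unless
new edges appear. -/
def Quiet (h : List Event) : Prop :=
  ∀ u v, (graph h).Adj u v → Event.depart u ∈ h ∨ Event.depart v ∈ h

/-- The continuation of `h` by `p` new vertices, each adjacent to all of `S`, and the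
departures of the vertices in `ds`. -/
def block (h : List Event) (S : Finset ℕ) (p : ℕ) (ds : List ℕ) : List Event :=
  h ++ (List.replicate p (Event.arrive S) ++ ds.map Event.depart)

section Block

variable {h : List Event} {S : Finset ℕ} {p : ℕ} {ds : List ℕ}

lemma numArrived_block (h : List Event) (S : Finset ℕ) (p : ℕ) (ds : List ℕ) :
    numArrived (block h S p ds) = numArrived h + p := by
  simp [block, numArrived_append, numArrived_replicate, numArrived_map_depart]

lemma depart_mem_block {v : ℕ} :
    Event.depart v ∈ block h S p ds ↔ Event.depart v ∈ h ∨ v ∈ ds := by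
  simp [block]

/-- The block adds the complete bipartite graph between `S` and the new vertices. -/
lemma graph_block_adj (hS : ∀ u ∈ S, u < numArrived h) {u v : ℕ} :
    (graph (block h S p ds)).Adj u v ↔ (graph h).Adj u v ∨
      (u ∈ S ∧ v ∈ Finset.Ico (numArrived h) (numArrived h + p)) ∨
      (v ∈ S ∧ u ∈ Finset.Ico (numArrived h) (numArrived h + p)) := by
  have harr : arrivals (block h S p ds) = arrivals h ++ List.replicate p S := by
    simp [block, arrivals_append, arrivals_replicate, arrivals_map_depart]
  have key : ∀ a b : ℕ, (∃ N, (arrivals (block h S p ds))[b]? = some N ∧ a ∈ N) ↔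
      (∃ N, (arrivals h)[b]? = some N ∧ a ∈ N) ∨
        (a ∈ S ∧ b ∈ Finset.Ico (numArrived h) (numArrived h + p)) := by
    intro a b
    rw [harr, Finset.mem_Ico]
    rcases lt_or_ge b (arrivals h).length with hlt | hge
    · rw [List.getElem?_append_left hlt]
      have : ¬ numArrived h ≤ b := not_le.2 hlt
      simp [this]
    · rw [List.getElem?_append_right hge, List.getElem?_replicate,
        List.getElem?_eq_none hge]
      have h1 : numArrived h ≤ b := hge
      have h2 : b - (arrivals h).length < p ↔ b < numArrived h + p := by
        unfold numArrived at h1 ⊢; omega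
      simp only [h2]
      split_ifs with h3 <;> simp [h1, h3]
  rw [graph_adj, graph_adj, key, key]
  have hne : ∀ a b : ℕ, a ∈ S → b ∈ Finset.Ico (numArrived h) (numArrived h + p) → a ≠ b := by
    intro a b ha hb hab
    have := hS a ha
    rw [Finset.mem_Ico] at hb
    omega
  constructor
  · rintro ⟨h0, (h1 | h1) | (h1 | h1)⟩
    exacts [.inl ⟨h0, .inl h1⟩, .inr (.inl h1), .inl ⟨h0, .inr h1⟩, .inr (.inr h1)]
  · rintro (⟨h0, h1 | h1⟩ | h1 | h1)
    · exact ⟨h0, .inl (.inl h1)⟩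
    · exact ⟨h0, .inr (.inl h1)⟩
    · exact ⟨hne _ _ h1.1 h1.2, .inl (.inr h1)⟩
    · exact ⟨(hne _ _ h1.1 h1.2).symm, .inr (.inr h1)⟩

lemma Valid.block (hv : Valid h) (hS : ∀ u ∈ S, Present h u) (hnd : ds.Nodup)
    (hds : ∀ d ∈ ds, d ∈ S ∨ d ∈ Finset.Ico (numArrived h) (numArrived h + p)) :
    Valid (block h S p ds) := by
  unfold FullyOnline.block
  rw [← List.append_assoc]
  refine (hv.replicate_arrive hS p).map_depart hnd fun d hd => ⟨?_, ?_⟩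
  · rw [numArrived_append, numArrived_replicate]
    rcases hds d hd with h1 | h1
    · exact (hS d h1).1.trans_le (Nat.le_add_right _ _)
    · exact (Finset.mem_Ico.1 h1).2
  · have : Event.depart d ∉ h := by
      rcases hds d hd with h1 | h1
      · exact (hS d h1).2
      · exact hv.not_depart_mem (Finset.mem_Ico.1 h1).1
    simp [this]

end Block

/-! ### Positions of the adversary -/

/-- The positions an adversary moves between. The set `S` consists of present vertices whose
partners in the optimum are still to come: the graph has a 2-colouring that is constant on `S`,
and a matching of size `K`, given by its set of edges, that avoids `S`. -/
structure Position (h : List Event) (S : Finset ℕ) (K : ℕ) : Prop where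
  valid : Valid h
  quiet : Quiet h
  present : ∀ s ∈ S, Present h s
  colouring : ∃ c : ℕ → Bool, ∃ b, (∀ u v, (graph h).Adj u v → c u ≠ c v) ∧ ∀ s ∈ S, c s = b
  matching : ∃ P : Finset (Sym2 ℕ), P.card = K ∧ (∀ e ∈ P, e ∈ (graph h).edgeSet) ∧
    (∀ e ∈ P, ∀ f ∈ P, ∀ v, v ∈ e → v ∈ f → e = f) ∧ ∀ e ∈ P, ∀ v ∈ e, v ∉ S

lemma Position.nil : Position [] ∅ 0 where
  valid := .nil
  quiet u v h := by simp [graph_adj, arrivals] at h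
  present := by simp
  colouring := ⟨fun _ => true, true, fun u v h => by simp [graph_adj, arrivals] at h, by simp⟩
  matching := ⟨∅, by simp⟩

/-- The move of the adversary: after a block in which all of `S` or all new vertices depart,
the matching is extended by a set `Q` of pairs from the block, and the game goes on with a
set `S'` that meets neither the pairs nor the departed vertices. -/
lemma Position.block {h : List Event} {S S' : Finset ℕ} {K p : ℕ} {ds : List ℕ}
    (hp : Position h S K) (hnd : ds.Nodup)
    (hds : ∀ d ∈ ds, d ∈ S ∨ d ∈ Finset.Ico (numArrived h) (numArrived h + p))
    (hside : (S' ⊆ S ∧ ∀ w ∈ Finset.Ico (numArrived h) (numArrived h + p), w ∈ ds) ∨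
      (S' ⊆ Finset.Ico (numArrived h) (numArrived h + p) ∧ ∀ u ∈ S, u ∈ ds))
    (hS'ds : ∀ s ∈ S', s ∉ ds)
    (Q : Finset (ℕ × ℕ))
    (hQ : ∀ q ∈ Q, q.1 ∈ S ∧ q.2 ∈ Finset.Ico (numArrived h) (numArrived h + p))
    (hQ1 : ∀ q ∈ Q, ∀ q' ∈ Q, q.1 = q'.1 → q = q')
    (hQ2 : ∀ q ∈ Q, ∀ q' ∈ Q, q.2 = q'.2 → q = q')
    (hQS : ∀ q ∈ Q, q.1 ∉ S' ∧ q.2 ∉ S') :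
    Position (block h S p ds) S' (K + Q.card) := by
  have hlt : ∀ u ∈ S, u < numArrived h := fun u hu => (hp.present u hu).1
  have hsep : ∀ a b : ℕ, a ∈ S → b ∈ Finset.Ico (numArrived h) (numArrived h + p) → a ≠ b := by
    intro a b ha hb hab
    have := hlt a ha
    rw [Finset.mem_Ico] at hb
    omega
  refine ⟨hp.valid.block hp.present hnd hds, ?_, ?_, ?_, ?_⟩
  · intro u v huv
    rw [depart_mem_block, depart_mem_block]
    rcases (graph_block_adj hlt).1 huv with h1 | h1 | h1
    · rcases hp.quiet u v h1 with h2 | h2 <;> simp [h2]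
    · rcases hside with ⟨_, h2⟩ | ⟨_, h2⟩
      · exact .inr (.inr (h2 _ h1.2))
      · exact .inl (.inr (h2 _ h1.1))
    · rcases hside with ⟨_, h2⟩ | ⟨_, h2⟩
      · exact .inl (.inr (h2 _ h1.2))
      · exact .inr (.inr (h2 _ h1.1))
  · intro s hs
    refine ⟨?_, ?_⟩
    · rw [numArrived_block]
      rcases hside with ⟨h1, _⟩ | ⟨h1, _⟩
      · exact (hlt s (h1 hs)).trans_le (Nat.le_add_right _ _)
      · exact (Finset.mem_Ico.1 (h1 hs)).2
    · rw [depart_mem_block, not_or]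
      refine ⟨?_, hS'ds s hs⟩
      rcases hside with ⟨h1, _⟩ | ⟨h1, _⟩
      · exact (hp.present s (h1 hs)).2
      · exact hp.valid.not_depart_mem (Finset.mem_Ico.1 (h1 hs)).1
  · obtain ⟨c, b, hc, hb⟩ := hp.colouring
    refine ⟨fun v => if v < numArrived h then c v else !b, ?_⟩
    have hcS : ∀ u ∈ S, (if u < numArrived h then c u else !b) = b := fun u hu => by
      simp [hlt u hu, hb u hu]
    have hcW : ∀ w ∈ Finset.Ico (numArrived h) (numArrived h + p),
        (if w < numArrived h then c w else !b) = !b := fun w hw => by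
      rw [if_neg (not_lt.2 (Finset.mem_Ico.1 hw).1)]
    rcases hside with ⟨h1, _⟩ | ⟨h1, _⟩
    · refine ⟨b, ?_, fun s hs => hcS s (h1 hs)⟩
      intro u v huv
      rcases (graph_block_adj hlt).1 huv with h1 | h1 | h1
      · obtain ⟨hu, hv⟩ := hp.valid.lt_numArrived h1
        simpa [hu, hv] using hc u v h1
      · simp only [hcS u h1.1, hcW v h1.2]; simp
      · simp only [hcS v h1.1, hcW u h1.2]; simp
    · refine ⟨!b, ?_, fun s hs => hcW s (h1 hs)⟩
      intro u v huv
      rcases (graph_block_adj hlt).1 huv with h1 | h1 | h1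
      · obtain ⟨hu, hv⟩ := hp.valid.lt_numArrived h1
        simpa [hu, hv] using hc u v h1
      · simp only [hcS u h1.1, hcW v h1.2]; simp
      · simp only [hcS v h1.1, hcW u h1.2]; simp
  · obtain ⟨P, hPc, hPe, hPd, hPS⟩ := hp.matching
    have hPlt : ∀ e ∈ P, ∀ v ∈ e, v < numArrived h := by
      intro e he
      induction e with | _ a b =>
      have := hp.valid.lt_numArrived (hPe _ he)
      intro v hv
      rcases Sym2.mem_iff.1 hv with rfl | rfl
      exacts [this.1, this.2]
    have hPQ : ∀ e ∈ P, ∀ q ∈ Q, ∀ v, v ∈ e → v ∈ s(q.1, q.2) → False := by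
      intro e he q hq v hv hvq
      rcases Sym2.mem_iff.1 hvq with rfl | rfl
      · exact hPS e he _ hv (hQ q hq).1
      · exact absurd (hPlt e he _ hv) (not_lt.2 (Finset.mem_Ico.1 (hQ q hq).2).1)
    have hQQ : ∀ q ∈ Q, ∀ q' ∈ Q, ∀ v, v ∈ s(q.1, q.2) → v ∈ s(q'.1, q'.2) → q = q' := by
      intro q hq q' hq' v hv hv'
      rcases Sym2.mem_iff.1 hv with h1 | h1 <;> rcases Sym2.mem_iff.1 hv' with h2 | h2
      · exact hQ1 q hq q' hq' (h1.symm.trans h2)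
      · exact absurd (h1.symm.trans h2) (hsep _ _ (hQ q hq).1 (hQ q' hq').2)
      · exact absurd (h2.symm.trans h1) (hsep _ _ (hQ q' hq').1 (hQ q hq).2)
      · exact hQ2 q hq q' hq' (h1.symm.trans h2)
    refine ⟨P ∪ Q.image fun q => s(q.1, q.2), ?_, ?_, ?_, ?_⟩
    · rw [Finset.card_union_of_disjoint, hPc, Finset.card_image_of_injOn]
      · intro q hq q' hq' hqq
        simp only at hqq
        exact hQQ q hq q' hq' q.1 (by simp) (hqq ▸ by simp)
      · rw [Finset.disjoint_left]
        intro e he he'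
        obtain ⟨q, hq, rfl⟩ := Finset.mem_image.1 he'
        exact hPQ _ he q hq q.1 (by simp) (by simp)
    · intro e he
      rcases Finset.mem_union.1 he with h1 | h1
      · exact SimpleGraph.edgeSet_mono (graph_mono _ _) (hPe e h1)
      · obtain ⟨q, hq, rfl⟩ := Finset.mem_image.1 h1
        exact (graph_block_adj hlt).2 (.inr (.inl (hQ q hq)))
    · intro e he f hf v hve hvf
      rcases Finset.mem_union.1 he with h1 | h1 <;> rcases Finset.mem_union.1 hf with h2 | h2
      · exact hPd e h1 f h2 v hve hvf
      · obtain ⟨q, hq, rfl⟩ := Finset.mem_image.1 h2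
        exact (hPQ e h1 q hq v hve hvf).elim
      · obtain ⟨q, hq, rfl⟩ := Finset.mem_image.1 h1
        exact (hPQ f h2 q hq v hvf hve).elim
      · obtain ⟨q, hq, rfl⟩ := Finset.mem_image.1 h1
        obtain ⟨q', hq', rfl⟩ := Finset.mem_image.1 h2
        rw [hQQ q hq q' hq' v hve hvf]
    · intro e he v hv hvS
      rcases Finset.mem_union.1 he with h1 | h1
      · rcases hside with ⟨h2, _⟩ | ⟨h2, _⟩
        · exact hPS e h1 v hv (h2 hvS)
        · exact absurd (hPlt e h1 v hv) (not_lt.2 (Finset.mem_Ico.1 (h2 hvS)).1)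
      · obtain ⟨q, hq, rfl⟩ := Finset.mem_image.1 h1
        rcases Sym2.mem_iff.1 hv with rfl | rfl
        exacts [(hQS q hq).1 hvS, (hQS q hq).2 hvS]

/-- At the end all remaining vertices depart. The graph does not change, it is bipartite, and the
matching of the position is a lower bound for the optimum. -/
lemma Position.exists_isInstance {h : List Event} {S : Finset ℕ} {K : ℕ} (hp : Position h S K) :
    ∃ ds : List ℕ, IsInstance (h ++ ds.map Event.depart) ∧
      (graph (h ++ ds.map Event.depart)).IsBipartite ∧ K ≤ opt (h ++ ds.map Event.depart) := by
  classical
  refine ⟨(List.range (numArrived h)).filter fun v => Event.depart v ∉ h, ⟨?_, ?_⟩, ?_, ?_⟩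
  · refine hp.valid.map_depart (List.nodup_range.filter _) fun u hu => ?_
    simpa [Present] using hu
  · intro v hv
    rw [numArrived_append, numArrived_map_depart, add_zero] at hv
    by_cases hd : Event.depart v ∈ h <;> simp [hd, hv]
  · rw [graph_append_depart]
    obtain ⟨c, b, hc, -⟩ := hp.colouring
    exact (SimpleGraph.Coloring.mk (G := graph h) c fun {u v} huv => hc u v huv).colorable
  · unfold opt
    rw [graph_append_depart]
    obtain ⟨P, hPc, hPe, hPd, -⟩ := hp.matching
    refine le_csSup ⟨(Finset.range (numArrived h)).sym2.card, ?_⟩ ?_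
    · rintro k ⟨M, -, rfl⟩
      rw [← Set.ncard_coe_finset]
      refine Set.ncard_le_ncard (fun e he => ?_) (Finset.finite_toSet _)
      have he' := M.edgeSet_subset he
      induction e with | _ a b =>
      have := hp.valid.lt_numArrived he'
      simp [this]
    · refine ⟨{ verts := {v | ∃ e ∈ P, v ∈ e}
                Adj := fun a b => s(a, b) ∈ P
                adj_sub := fun {a b} hab => hPe _ hab
                edge_vert := fun {a b} hab => ⟨_, hab, by simp⟩
                symm := ⟨fun a b hab => by rwa [Sym2.eq_swap]⟩ }, ?_, ?_⟩
      · rintro v ⟨e, he, hv⟩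
        obtain ⟨w, rfl⟩ := Sym2.mem_iff_exists.1 hv
        refine ⟨w, he, fun w' hw' => ?_⟩
        exact Sym2.congr_right.1 (hPd _ hw' _ he v (by simp) (by simp))
      · rw [← hPc, ← Set.ncard_coe_finset]
        congr 1
        ext e
        induction e with | _ a b =>
        simp

/-! ### The values and loads of an algorithm -/

namespace FractionalAlgorithm

variable (A : FractionalAlgorithm)

/-- In the course of a continuation, the value of an edge stays as it is if one of its endpoints
departed before; and the value of a pair that never becomes an edge does not change. -/
lemma x_append {h l : List Event} (hv : Valid (h ++ l)) {s : Sym2 ℕ}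
    (hs : s ∉ (graph (h ++ l)).edgeSet ∨ ∃ v ∈ s, Event.depart v ∈ h) :
    A.x (h ++ l) s = A.x h s := by
  induction l using List.reverseRecOn with
  | nil => simp
  | append_singleton l e ih =>
    rw [← List.append_assoc] at hv hs ⊢
    rw [A.frozen _ _ hv s, ih hv.of_append]
    · exact hs.imp_left fun h1 h2 => h1 (SimpleGraph.edgeSet_mono (graph_mono _ _) h2)
    · rintro ⟨h1, h2⟩
      rcases hs with h3 | ⟨v, h3, h4⟩
      · exact h3 h1
      · exact h2 v h3 (List.mem_append_left _ h4)

lemma x_eq_zero {h : List Event} (hv : Valid h) {s : Sym2 ℕ} (hs : s ∉ (graph h).edgeSet) :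
    A.x h s = 0 := by
  have := A.x_append (h := []) (l := h) hv (.inl hs)
  rw [A.start] at this
  exact this

lemma x_nonneg {h : List Event} (hv : Valid h) (s : Sym2 ℕ) : 0 ≤ A.x h s := by
  induction h using List.reverseRecOn with
  | nil => exact (A.start s).ge
  | append_singleton l e ih => exact (ih hv.of_append).trans (A.mono _ _ hv s)

/-- The total value of the edges at the vertex `v`. -/
noncomputable def load (h : List Event) (v : ℕ) : ℝ :=
  ∑ u ∈ Finset.range (numArrived h), A.x h s(u, v)

lemma load_nonneg {h : List Event} (hv : Valid h) (v : ℕ) : 0 ≤ A.load h v :=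
  Finset.sum_nonneg fun _ _ => A.x_nonneg hv _

lemma load_le_one {h : List Event} (hv : Valid h) (v : ℕ) : A.load h v ≤ 1 := A.load_le h hv v

lemma value_append_depart {h : List Event} (hq : Quiet h) {ds : List ℕ}
    (hv : Valid (h ++ ds.map Event.depart)) :
    A.value (h ++ ds.map Event.depart) = A.value h := by
  unfold value
  rw [numArrived_append, numArrived_map_depart, add_zero]
  refine Finset.sum_congr rfl fun s _ => A.x_append hv ?_
  rw [graph_append_depart]
  by_cases hs : s ∈ (graph h).edgeSet
  · right
    induction s with | _ a b =>
    rcases hq a b hs with h1 | h1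
    exacts [⟨a, by simp, h1⟩, ⟨b, by simp, h1⟩]
  · exact .inl hs

section Block

variable {h : List Event} {S : Finset ℕ} {p : ℕ} {ds : List ℕ}

/-- A block changes values only on the edges between `S` and the new vertices. -/
lemma x_block (hq : Quiet h) (hS : ∀ u ∈ S, u < numArrived h) (hv : Valid (block h S p ds))
    {a b : ℕ}
    (hab : ¬ (a ∈ S ∧ b ∈ Finset.Ico (numArrived h) (numArrived h + p)))
    (hba : ¬ (b ∈ S ∧ a ∈ Finset.Ico (numArrived h) (numArrived h + p))) :
    A.x (block h S p ds) s(a, b) = A.x h s(a, b) := by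
  refine A.x_append hv ?_
  by_cases hs : (graph h).Adj a b
  · right
    rcases hq a b hs with h1 | h1
    exacts [⟨a, by simp, h1⟩, ⟨b, by simp, h1⟩]
  · left
    intro h1
    rcases (graph_block_adj hS).1 h1 with h2 | h2 | h2
    exacts [hs h2, hab h2, hba h2]

lemma x_eq_zero_of_le (hv : Valid h) {u w : ℕ} (hw : numArrived h ≤ w) :
    A.x h s(u, w) = 0 :=
  A.x_eq_zero hv fun h1 => absurd (hv.lt_numArrived h1).2 (not_lt.2 hw)

lemma load_block_old (hq : Quiet h) (hS : ∀ u ∈ S, u < numArrived h)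
    (hv : Valid (block h S p ds)) {u : ℕ} (hu : u ∈ S) :
    A.load (block h S p ds) u = A.load h u +
      ∑ w ∈ Finset.Ico (numArrived h) (numArrived h + p), A.x (block h S p ds) s(u, w) := by
  unfold load
  rw [numArrived_block, ← Finset.sum_range_add_sum_Ico _ (Nat.le_add_right (numArrived h) p)]
  congr 1
  · refine Finset.sum_congr rfl fun v hv' => A.x_block hq hS hv ?_ ?_
    · rintro ⟨_, h1⟩
      have := hS u hu
      rw [Finset.mem_Ico] at h1
      omega
    · rintro ⟨_, h1⟩
      rw [Finset.mem_Ico] at h1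
      rw [Finset.mem_range] at hv'
      omega
  · exact Finset.sum_congr rfl fun w _ => by rw [Sym2.eq_swap]

lemma load_block_new (hq : Quiet h) (hS : ∀ u ∈ S, u < numArrived h)
    (hv : Valid (block h S p ds)) {w : ℕ}
    (hw : w ∈ Finset.Ico (numArrived h) (numArrived h + p)) :
    A.load (block h S p ds) w = ∑ u ∈ S, A.x (block h S p ds) s(u, w) := by
  unfold load
  symm
  refine Finset.sum_subset (fun u hu => ?_) fun u _ hu => ?_
  · rw [Finset.mem_range, numArrived_block]
    exact (hS u hu).trans_le (Nat.le_add_right _ _)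
  · rw [A.x_block hq hS hv (fun h1 => hu h1.1), A.x_eq_zero_of_le hv.of_append]
    · exact (Finset.mem_Ico.1 hw).1
    · rintro ⟨h1, _⟩
      have := hS w h1
      rw [Finset.mem_Ico] at hw
      omega

lemma value_block (hq : Quiet h) (hS : ∀ u ∈ S, u < numArrived h)
    (hv : Valid (block h S p ds)) :
    A.value (block h S p ds) = A.value h +
      ∑ u ∈ S, ∑ w ∈ Finset.Ico (numArrived h) (numArrived h + p),
        A.x (block h S p ds) s(u, w) := by
  classical
  set n := numArrived h with hn
  set W := Finset.Ico n (n + p) with hW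
  set E := (S ×ˢ W).image fun q => s(q.1, q.2) with hE
  have hold : A.value h = ∑ s ∈ (Finset.range (n + p)).sym2, A.x h s := by
    refine Finset.sum_subset (Finset.sym2_mono (Finset.range_mono (Nat.le_add_right _ _))) ?_
    intro s _ hs
    refine A.x_eq_zero hv.of_append fun h1 => hs ?_
    induction s with | _ a b =>
    have := hv.of_append.lt_numArrived h1
    simp [this]
  have hsub : E ⊆ (Finset.range (n + p)).sym2 := by
    intro s hs
    obtain ⟨q, hq', rfl⟩ := Finset.mem_image.1 hs
    rw [Finset.mem_product, hW, Finset.mem_Ico] at hq'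
    have := hS _ hq'.1
    simp only [Finset.mk_mem_sym2_iff, Finset.mem_range]
    omega
  have hinj : Set.InjOn (fun q : ℕ × ℕ => s(q.1, q.2)) (S ×ˢ W : Finset (ℕ × ℕ)) := by
    rintro ⟨a, b⟩ hab ⟨c, d⟩ hcd heq
    simp only [Finset.coe_product, Set.mem_prod, Finset.mem_coe, hW, Finset.mem_Ico] at hab hcd
    have h1 := hS _ hab.1
    have h2 := hS _ hcd.1
    rcases Sym2.eq_iff.1 heq with ⟨rfl, rfl⟩ | ⟨rfl, rfl⟩
    · rfl
    · omega
  have hdiff : ∑ s ∈ (Finset.range (n + p)).sym2, (A.x (block h S p ds) s - A.x h s) =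
      ∑ s ∈ E, A.x (block h S p ds) s := by
    rw [← Finset.sum_subset hsub]
    · refine Finset.sum_congr rfl fun s hs => ?_
      obtain ⟨q, hq', rfl⟩ := Finset.mem_image.1 hs
      rw [Finset.mem_product, hW, Finset.mem_Ico] at hq'
      rw [A.x_eq_zero_of_le hv.of_append hq'.2.1, sub_zero]
    · intro s _ hs
      induction s with | _ a b =>
      rw [A.x_block hq hS hv, sub_self]
      · intro h1
        exact hs (Finset.mem_image.2 ⟨(a, b), Finset.mem_product.2 h1, rfl⟩)
      · intro h1
        exact hs (Finset.mem_image.2 ⟨(b, a), Finset.mem_product.2 h1, Sym2.eq_swap⟩)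
  rw [Finset.sum_image hinj, Finset.sum_product, Finset.sum_sub_distrib, ← hold] at hdiff
  have hval : A.value (block h S p ds) =
      ∑ s ∈ (Finset.range (n + p)).sym2, A.x (block h S p ds) s := by
    rw [value, numArrived_block]
  rw [hval]
  linarith

/-- The value gained in a block, counted at the vertices of `S`. -/
lemma value_block_old (hq : Quiet h) (hS : ∀ u ∈ S, u < numArrived h)
    (hv : Valid (block h S p ds)) :
    A.value (block h S p ds) + ∑ u ∈ S, A.load h u =
      A.value h + ∑ u ∈ S, A.load (block h S p ds) u := by
  rw [A.value_block hq hS hv,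
    Finset.sum_congr rfl fun u hu => A.load_block_old hq hS hv hu, Finset.sum_add_distrib]
  ring

/-- The value gained in a block, counted at the new vertices. -/
lemma value_block_new (hq : Quiet h) (hS : ∀ u ∈ S, u < numArrived h)
    (hv : Valid (block h S p ds)) :
    A.value (block h S p ds) = A.value h +
      ∑ w ∈ Finset.Ico (numArrived h) (numArrived h + p), A.load (block h S p ds) w := by
  rw [A.value_block hq hS hv, Finset.sum_comm,
    Finset.sum_congr rfl fun w hw => A.load_block_new hq hS hv hw]

end Block

end FractionalAlgorithm

/-! ### The phases of the game -/

/-- Discarding the smallest values of `f` does not decrease the average. -/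
lemma exists_subset_average_le {ι : Type*} [DecidableEq ι] (f : ι → ℝ) (k : ℕ) (W : Finset ι)
    (hk : k ≤ W.card) :
    ∃ T ⊆ W, T.card = k ∧ (k : ℝ) * ∑ w ∈ W, f w ≤ W.card * ∑ w ∈ T, f w := by
  induction h : W.card - k generalizing W with
  | zero => exact ⟨W, subset_rfl, by omega, by rw [show k = W.card by omega]⟩
  | succ d ih =>
    rcases Nat.eq_zero_or_pos k with rfl | hk0
    · exact ⟨∅, by simp, by simp, by simp⟩
    have hne : W.Nonempty := Finset.card_pos.1 (by omega)
    obtain ⟨s, hs, hmin⟩ := W.exists_min_image f hne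
    have hcard : (W.erase s).card + 1 = W.card := Finset.card_erase_add_one hs
    obtain ⟨T, hT, hTk, hle⟩ := ih (W.erase s) (by omega) (by omega)
    refine ⟨T, hT.trans (W.erase_subset s), hTk, ?_⟩
    have hsum : ∑ w ∈ W.erase s, f w + f s = ∑ w ∈ W, f w := Finset.sum_erase_add _ _ hs
    have hmin' : (W.erase s).card * f s ≤ ∑ w ∈ W.erase s, f w := by
      rw [← nsmul_eq_mul]
      exact Finset.card_nsmul_le_sum _ _ _ fun w hw => hmin w (Finset.mem_of_mem_erase hw)
    set c : ℝ := ((W.erase s).card : ℝ) with hc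
    have hc0 : 0 < c := by
      rw [hc, Nat.cast_pos]; omega
    have hcW : (W.card : ℝ) = c + 1 := by rw [hc, ← hcard]; push_cast; ring
    have hk' : (0 : ℝ) < k := by exact_mod_cast hk0
    rw [hcW, ← hsum]
    refine le_of_mul_le_mul_left ?_ hc0
    nlinarith [mul_le_mul_of_nonneg_left hmin' hk'.le,
      mul_le_mul_of_nonneg_left hle (by linarith : 0 ≤ c + 1)]

variable (A : FractionalAlgorithm) {h : List Event} {S : Finset ℕ} {K : ℕ}

/-- A new vertex arrives, adjacent to all of `S`, and departs. The adversary declares a least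
loaded vertex `s` of `S` to be its partner in the optimum. -/
lemma Position.exists_online_vertex (hp : Position h S K) (hne : S.Nonempty) :
    ∃ h', ∃ s ∈ S, Position h' (S.erase s) (K + 1) ∧ ∃ x ≤ (1 : ℝ),
      A.value h' = A.value h + x ∧ ∑ u ∈ S, A.load h' u = ∑ u ∈ S, A.load h u + x ∧
      S.card * A.load h' s ≤ ∑ u ∈ S, A.load h' u := by
  have hlt : ∀ u ∈ S, u < numArrived h := fun u hu => (hp.present u hu).1
  set n := numArrived h with hn
  set h' := FullyOnline.block h S 1 [n] with hh'
  have hW : Finset.Ico n (n + 1) = {n} := by simp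
  obtain ⟨s, hs, hmin⟩ := S.exists_min_image (A.load h') hne
  have hnS : n ∉ S := fun hnS => lt_irrefl _ (hlt n hnS)
  have hp' : Position h' (S.erase s) (K + 1) := by
    have := hp.block (S' := S.erase s) (p := 1) (ds := [n]) (by simp) (by simp [← hn])
      (.inl ⟨S.erase_subset s, by simp [← hn]⟩)
      (fun u hu => by
        have := hlt u (Finset.mem_of_mem_erase hu)
        simp only [List.mem_singleton]
        omega)
      {(s, n)} (by simp [← hn, hs]) (by simp) (by simp) (by simp [hnS])
    simpa using this
  refine ⟨h', s, hs, hp', A.load h' n, A.load_le_one hp'.valid n, ?_, ?_, ?_⟩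
  · rw [hh', A.value_block_new hp.quiet hlt hp'.valid, ← hn, hW, Finset.sum_singleton]
  · have h1 := A.value_block_old hp.quiet hlt hp'.valid
    have h2 := A.value_block_new hp.quiet hlt hp'.valid
    rw [← hn, hW, Finset.sum_singleton] at h2
    rw [← hh'] at h1 h2
    linarith
  · rw [← nsmul_eq_mul]
    exact Finset.card_nsmul_le_sum _ _ _ hmin

/-- The upper triangular phase: `q` times a new vertex arrives, adjacent to the remaining vertices
of the set, and departs. When `j` vertices remain, a gain of `x` raises their average load by at
least `x / j`; with `lam` as the price of average load, the gain exceeds its price by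
`(1 - lam / j) * x ≤ 1 - lam / j`. -/
lemma Position.exists_triangular {r : ℕ} (hr : 0 < r) {lam : ℝ} (hlam : 0 ≤ lam)
    (hlamr : lam ≤ r) (q : ℕ) (hp : Position h S K) (hS : S.card = r + q) :
    ∃ h' S', Position h' S' (K + q) ∧ S'.card = r ∧
      A.value h' ≤ A.value h + ∑ j ∈ Finset.Ioc r (r + q), (1 - lam / j) +
        lam * ((∑ u ∈ S', A.load h' u) / r - (∑ u ∈ S, A.load h u) / (r + q : ℕ)) := by
  induction q generalizing h S K with
  | zero => exact ⟨h, S, hp, hS, by simp⟩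
  | succ q ih =>
    obtain ⟨h₁, s, hs, hp₁, x, hx, hval, hload, hmin⟩ :=
      hp.exists_online_vertex A (Finset.card_pos.1 (by omega))
    obtain ⟨h', S', hp', hS', hle⟩ := ih hp₁ (by rw [Finset.card_erase_of_mem hs]; omega)
    refine ⟨h', S', by rwa [show K + (q + 1) = K + 1 + q by ring], hS', ?_⟩
    have hsum : ∑ u ∈ S.erase s, A.load h₁ u + A.load h₁ s = ∑ u ∈ S, A.load h₁ u :=
      Finset.sum_erase_add _ _ hs
    rw [← add_assoc, Finset.sum_Ioc_succ_top (Nat.le_add_right r q)]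
    rw [hS] at hmin
    set L := ∑ u ∈ S, A.load h u
    set L₁ := ∑ u ∈ S.erase s, A.load h₁ u
    set j : ℝ := ((r + q + 1 : ℕ) : ℝ) with hj
    have hj' : ((r + q : ℕ) : ℝ) = j - 1 := by rw [hj]; push_cast; ring
    have hrr : (r : ℝ) ≤ j - 1 := by rw [← hj']; exact_mod_cast Nat.le_add_right r q
    have hr' : (0 : ℝ) < r := by exact_mod_cast hr
    have havg : (L + x) / j ≤ L₁ / (j - 1) := by
      rw [div_le_div_iff₀ (by linarith) (by linarith)]
      have hmin' : j * A.load h₁ s ≤ L + x := by rw [← hload]; exact hmin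
      nlinarith
    have hx' : (1 - lam / j) * x ≤ 1 - lam / j := by
      refine mul_le_of_le_one_right ?_ hx
      rw [sub_nonneg, div_le_one (by linarith)]
      linarith
    rw [hj'] at hle
    have hprice := mul_le_mul_of_nonneg_left havg hlam
    have e1 : lam * ((L + x) / j) = lam * (L / j) + lam / j * x := by ring
    rw [hval] at hle
    linarith

/-- When all vertices of `S` are matched online, the gain is at most what is left of the capacity
of `S`. -/
lemma Position.exists_saturating (hp : Position h S K) :
    ∃ h', Position h' ∅ (K + S.card) ∧
      A.value h' ≤ A.value h + (S.card - ∑ u ∈ S, A.load h u) := by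
  induction hk : S.card generalizing h S K with
  | zero =>
    obtain rfl := Finset.card_eq_zero.1 hk
    exact ⟨h, hp, by simp⟩
  | succ k ih =>
    obtain ⟨h₁, s, hs, hp₁, x, -, hval, hload, -⟩ :=
      hp.exists_online_vertex A (Finset.card_pos.1 (by omega))
    obtain ⟨h', hp', hle⟩ := ih hp₁ (by rw [Finset.card_erase_of_mem hs]; omega)
    refine ⟨h', by rwa [show K + (k + 1) = K + 1 + k by ring], ?_⟩
    have hsum : ∑ u ∈ S.erase s, A.load h₁ u + A.load h₁ s = ∑ u ∈ S, A.load h₁ u :=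
      Finset.sum_erase_add _ _ hs
    have := A.load_le_one hp₁.valid s
    push_cast
    linarith

/-- The change of sides: `p` new vertices arrive, adjacent to all of `S`, and then `S` departs. The
gain `y` is at most the remaining capacity of `S`, and it loads the new vertices. The least
loaded of them become the partners of `S` in the optimum; the others form the new set. -/
lemma Position.exists_change_sides (hp : Position h S K) {p : ℕ} (hSp : S.card ≤ p) :
    ∃ h' S', Position h' S' (K + S.card) ∧ S'.card = p - S.card ∧ ∃ y,
      A.value h' = A.value h + y ∧ y ≤ S.card - ∑ u ∈ S, A.load h u ∧
      ((p - S.card : ℕ) : ℝ) * y ≤ p * ∑ u ∈ S', A.load h' u := by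
  have hlt : ∀ u ∈ S, u < numArrived h := fun u hu => (hp.present u hu).1
  set n := numArrived h with hn
  set h' := FullyOnline.block h S p S.toList with hh'
  set W := Finset.Ico n (n + p) with hW
  have hWc : W.card = p := by simp [hW]
  have hdisj : ∀ u ∈ S, u ∉ W := fun u hu huW => by
    have := hlt u hu
    rw [hW, Finset.mem_Ico] at huW
    omega
  obtain ⟨T, hTW, hTc, hTle⟩ := exists_subset_average_le (A.load h') (p - S.card) W (by omega)
  have hcard : S.card = (W \ T).card := by
    rw [Finset.card_sdiff_of_subset hTW]
    omega
  let f := Finset.equivOfCardEq hcard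
  let Q : Finset (ℕ × ℕ) := Finset.univ.image fun u : S => (u.1, (f u).1)
  have hQc : Q.card = S.card := by
    rw [Finset.card_image_of_injective, Finset.card_univ, Fintype.card_coe]
    intro u v huv
    exact Subtype.ext (Prod.ext_iff.1 huv).1
  have hp' : Position h' T (K + S.card) := by
    rw [← hQc]
    refine hp.block S.nodup_toList (fun d hd => .inl (Finset.mem_toList.1 hd))
      (.inr ⟨hTW, fun u hu => Finset.mem_toList.2 hu⟩)
      (fun s hs hsS => hdisj s (Finset.mem_toList.1 hsS) (hTW hs)) Q ?_ ?_ ?_ ?_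
    · intro q hq
      obtain ⟨u, -, rfl⟩ := Finset.mem_image.1 hq
      exact ⟨u.2, (Finset.mem_sdiff.1 (f u).2).1⟩
    · intro q hq q' hq' heq
      obtain ⟨u, -, rfl⟩ := Finset.mem_image.1 hq
      obtain ⟨v, -, rfl⟩ := Finset.mem_image.1 hq'
      rw [Subtype.ext heq]
    · intro q hq q' hq' heq
      obtain ⟨u, -, rfl⟩ := Finset.mem_image.1 hq
      obtain ⟨v, -, rfl⟩ := Finset.mem_image.1 hq'
      rw [f.injective (Subtype.ext heq)]
    · intro q hq
      obtain ⟨u, -, rfl⟩ := Finset.mem_image.1 hq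
      exact ⟨fun hu => hdisj _ u.2 (hTW hu), (Finset.mem_sdiff.1 (f u).2).2⟩
  have hold := A.value_block_old hp.quiet hlt hp'.valid
  have hnew := A.value_block_new hp.quiet hlt hp'.valid
  refine ⟨h', T, hp', hTc, ∑ w ∈ W, A.load h' w, hnew, ?_, ?_⟩
  · have hcap : ∑ u ∈ S, A.load h' u ≤ S.card := by
      simpa using Finset.sum_le_card_nsmul S (A.load h') 1
        fun u _ => A.load_le_one hp'.valid u
    rw [← hh'] at hold hnew
    linarith
  · rwa [hWc] at hTle

/-- The upper triangular phase on all of `S`. Once `r` vertices remain, the gain is bounded by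
their capacity. -/
lemma Position.exists_triangular_all {r q : ℕ} (hr : 0 < r) (hp : Position h S K)
    (hS : S.card = r + q) :
    ∃ h' S', Position h' S' (K + (r + q)) ∧
      A.value h' ≤ A.value h + ∑ j ∈ Finset.Ioc r (r + q), (1 - (r : ℝ) / j) +
        r * (1 - (∑ u ∈ S, A.load h u) / (r + q : ℕ)) := by
  obtain ⟨h₁, S₁, hp₁, hS₁, h1⟩ := hp.exists_triangular A hr (Nat.cast_nonneg r) le_rfl q hS
  obtain ⟨h₂, hp₂, h2⟩ := hp₁.exists_saturating A
  refine ⟨h₂, ∅, by rwa [show K + (r + q) = K + q + S₁.card by omega], ?_⟩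
  have hr' : (r : ℝ) ≠ 0 := by exact_mod_cast hr.ne'
  have e : (r : ℝ) * ((∑ u ∈ S₁, A.load h₁ u) / r) = ∑ u ∈ S₁, A.load h₁ u := by field_simp
  rw [hS₁] at h2
  linarith

/-- An instance with an optimum of at least `102` on which the algorithm gains less than
`0.6297 * 102`. -/
lemma exists_hard_instance : ∃ h, IsInstance h ∧ (graph h).IsBipartite ∧ 102 ≤ opt h ∧
    A.value h < 0.6297 * 102 := by
  obtain ⟨h₀, S₀, hp₀, hS₀, y₀, hv₀, hy₀, -⟩ :=
    Position.nil.exists_change_sides A (p := 30) (by simp)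
  have hL₀ : 0 ≤ ∑ u ∈ S₀, A.load h₀ u :=
    Finset.sum_nonneg fun u _ => A.load_nonneg hp₀.valid u
  -- Of the remaining capacity of the `18` vertices, a gain of `y` loads the next `90` vertices by
  -- `y / 90` on average, at the price `30` of the last phase. So capacity is worth
  -- `1 - 30 / 90 = 2 / 3` per unit, and `12 = 18 * (2 / 3)` is the price of average load here.
  obtain ⟨h₁, S₁, hp₁, hS₁, hv₁⟩ := hp₀.exists_triangular A (r := 18) (by norm_num)
    (lam := 12) (by norm_num) (by norm_num) 12 (by simpa using hS₀)
  obtain ⟨h₂, S₂, hp₂, hS₂, y, hv₂, hy, hL₂⟩ := hp₁.exists_change_sides A (p := 90) (by omega)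
  obtain ⟨h₃, S₃, hp₃, hv₃⟩ := hp₂.exists_triangular_all A (r := 30) (q := 42) (by norm_num)
    (by rw [hS₂, hS₁])
  obtain ⟨ds, hinst, hbip, hopt⟩ := hp₃.exists_isInstance
  refine ⟨_, hinst, hbip, le_trans (by rw [hS₁]; simp) hopt, ?_⟩
  rw [A.value_append_depart hp₃.quiet hinst.1]
  have hnil : A.value [] = 0 := by
    rw [FractionalAlgorithm.value]
    exact Finset.sum_eq_zero fun s _ => A.start s
  have hsum₁ : ∑ j ∈ Finset.Ioc (18 : ℕ) (18 + 12), (1 - (12 : ℝ) / j) ≤ 6.01 := by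
    have : ∑ j ∈ Finset.Ioc (18 : ℕ) (18 + 12), (1 - (12 : ℚ) / j) ≤ 6.01 := by decide +kernel
    have := (Rat.cast_le (K := ℝ)).2 this
    push_cast at this
    exact this
  have hsum₂ : ∑ j ∈ Finset.Ioc (30 : ℕ) (30 + 42), (1 - ((30 : ℕ) : ℝ) / j) ≤ 16.03 := by
    have : ∑ j ∈ Finset.Ioc (30 : ℕ) (30 + 42), (1 - ((30 : ℕ) : ℚ) / j) ≤ 16.03 := by
      decide +kernel
    have := (Rat.cast_le (K := ℝ)).2 this
    push_cast at this ⊢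
    exact this
  have hv₁' := hv₁.trans (add_le_add_left (add_le_add_right hsum₁ _) _)
  have hv₃' := hv₃.trans (add_le_add_left (add_le_add_right hsum₂ _) _)
  rw [hS₁] at hy hL₂
  simp only [Finset.card_empty, Finset.sum_empty] at hy₀
  norm_num at hy₀ hv₁' hv₃' hy hL₂ ⊢
  linarith

end FullyOnline

theorem theorem1 (A : FullyOnline.FractionalAlgorithm) :
    (∀ α : ℝ, A.IsCompetitive α → α ≤ 0.6297) ∧
    (∀ α : ℝ, A.IsCompetitiveOnBipartite α → α ≤ 0.6297) := by
  obtain ⟨h, hinst, hbip, hopt, hval⟩ := FullyOnline.exists_hard_instance A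
  have hopt' : (102 : ℝ) ≤ FullyOnline.opt h := by exact_mod_cast hopt
  have key : ∀ α : ℝ, α * (FullyOnline.opt h : ℝ) ≤ A.value h → α ≤ 0.6297 := by
    intro α hα
    by_contra! hlt
    nlinarith
  exact ⟨fun α hα => key α (hα h hinst trivial), fun α hα => key α (hα h hinst hbip)⟩
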